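/- All graphs are finite and simple. For a directed graph $D$ and distinct vertices $u,v$ of $D$, let $\kappa_D(u,v)$ be the maximum number of internally disjoint directed $u$–$v$ paths in $D$. If $D$ has order $n\ge 2$, its average connectivity is $$\bar{\kappa}(D)=\frac{1}{n(n-1)}\sum_{\substack{(u,v)\\ u\neq v}}\kappa_D(u,v),$$ where the sum runs over all ordered pairs of distinct vertices of $D$. For a graph $G$, let $\bar{\kappa}_{\max}(G)$ be the maximum of $\bar{\kappa}(D)$ over all orientations $D$ of $G$, an orientation of $G$ being a directed graph obtained by assigning one direction to every edge of $G$. Let $\kappa(G)$ be the connectivity of $G$, that is, the least number of vertices whose removal leaves a graph that is disconnected or has at most one vertex. Call $G$ minimally $2$-connected if $\kappa(G)=2$ and $\kappa(G-e)<2$ for every edge $e$ of $G$. Theorem. Let $G$ be a minimally $2$-connected graph of order $n\ge 3$. Then $$1\le \bar{\kappa}_{\max}(G)\le 1+\frac{(n-3)^2}{4n(n-1)}<\frac54 .$$ -/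

import Mathlib

namespace Digraph

variable {V : Type*}

/-- `l` is the list of successive vertices of a directed path from `u` to `v` in `D`
(no vertex is repeated). -/
structure IsDirPath (D : Digraph V) (u v : V) (l : List V) : Prop where
  nodup : l.Nodup
  chain : l.IsChain D.Adj
  head : l.head? = some u
  last : l.getLast? = some v

/-- `P` is a set of internally disjoint directed paths from `u` to `v` in `D`: any two different
members of `P` have no common vertex other than `u` and `v`. -/
structure IsDisjointPaths (D : Digraph V) (u v : V) (P : Finset (List V)) : Prop where
  isDirPath : ∀ l ∈ P, D.IsDirPath u v l
  disjoint : ∀ l ∈ P, ∀ m ∈ P, l ≠ m → ∀ x ∈ l, x ∈ m → x = u ∨ x = v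

/-- The connectivity `κ_D(u, v)` from `u` to `v`: the maximum number of internally disjoint
directed paths from `u` to `v` in `D` (used for `u ≠ v` only). -/
noncomputable def pathConnectivity (D : Digraph V) (u v : V) : ℕ :=
  sSup {k | ∃ P : Finset (List V), D.IsDisjointPaths u v P ∧ P.card = k}

/-- For finite `V`, the maximum that defines `pathConnectivity` exists. -/
theorem isGreatest_pathConnectivity [Fintype V] (D : Digraph V) (u v : V) :
    IsGreatest {k | ∃ P : Finset (List V), D.IsDisjointPaths u v P ∧ P.card = k}
      (D.pathConnectivity u v) := by
  have hfin : {l : List V | l.Nodup}.Finite :=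
    (List.finite_length_le V (Fintype.card V)).subset
      fun l (hl : l.Nodup) => hl.length_le_card
  have hb : BddAbove {k | ∃ P : Finset (List V), D.IsDisjointPaths u v P ∧ P.card = k} := by
    refine ⟨hfin.toFinset.card, ?_⟩
    rintro k ⟨P, hP, rfl⟩
    refine Finset.card_le_card fun l hl => ?_
    simpa using (hP.isDirPath l hl).nodup
  have hne : {k | ∃ P : Finset (List V), D.IsDisjointPaths u v P ∧ P.card = k}.Nonempty :=
    ⟨0, ∅, ⟨by simp, by simp⟩, rfl⟩
  exact ⟨Nat.sSup_mem hne hb, fun k hk => le_csSup hb hk⟩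

open Classical in
/-- The total connectivity `K(D)`: the sum of `κ_D(u, v)` over all ordered pairs of distinct
vertices. -/
noncomputable def totalConnectivity [Fintype V] (D : Digraph V) : ℕ :=
  ∑ p ∈ (Finset.univ : Finset V).offDiag, D.pathConnectivity p.1 p.2

/-- The average connectivity of `D`: the average of `κ_D(u, v)` over all ordered pairs of
distinct vertices. -/
noncomputable def averageConnectivity [Fintype V] (D : Digraph V) : ℝ :=
  (D.totalConnectivity : ℝ) / ((Fintype.card V : ℝ) * ((Fintype.card V : ℝ) - 1))

/-- `D` arises from the simple graph `G` by giving every edge exactly one direction. -/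
structure IsOrientationOf (D : Digraph V) (G : SimpleGraph V) : Prop where
  adj_iff : ∀ u v, G.Adj u v ↔ D.Adj u v ∨ D.Adj v u
  asymm : ∀ u v, D.Adj u v → ¬ D.Adj v u

end Digraph

namespace SimpleGraph

variable {V : Type*}

/-- The maximum average connectivity among all orientations of `G`. -/
noncomputable def maxAverageConnectivity [Fintype V] (G : SimpleGraph V) : ℝ :=
  sSup {x | ∃ D : Digraph V, D.IsOrientationOf G ∧ D.averageConnectivity = x}

/-- The maximum that defines `maxAverageConnectivity` exists. -/
theorem isGreatest_maxAverageConnectivity [Fintype V] (G : SimpleGraph V) :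
    IsGreatest {x | ∃ D : Digraph V, D.IsOrientationOf G ∧ D.averageConnectivity = x}
      G.maxAverageConnectivity := by
  have hD : Finite (Digraph V) := Finite.of_injective _ Digraph.adj_injective
  have hfin : {x | ∃ D : Digraph V, D.IsOrientationOf G ∧ D.averageConnectivity = x}.Finite :=
    (Set.toFinite {D : Digraph V | D.IsOrientationOf G}).image Digraph.averageConnectivity
  have hne : {x | ∃ D : Digraph V, D.IsOrientationOf G ∧ D.averageConnectivity = x}.Nonempty := by
    let e := Fintype.equivFin V
    refine ⟨_, ⟨fun a b => G.Adj a b ∧ e a < e b⟩, ⟨fun u v => ⟨fun h => ?_, ?_⟩, ?_⟩, rfl⟩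
    · rcases lt_or_gt_of_ne (e.injective.ne h.ne) with h' | h'
      · exact Or.inl ⟨h, h'⟩
      · exact Or.inr ⟨h.symm, h'⟩
    · rintro (h | h)
      · exact h.1
      · exact h.1.symm
    · intro u v h h'
      exact lt_asymm h.2 h'.2
  exact ⟨hne.csSup_mem hfin, fun x hx => le_csSup hfin.bddAbove hx⟩

/-- The connectivity `κ(G)`: the least number of vertices whose removal leaves a graph that is
disconnected or has at most one vertex. -/
noncomputable def vertexConnectivity [Fintype V] (G : SimpleGraph V) : ℕ :=
  sInf {k | ∃ S : Finset V, S.card = k ∧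
    (¬ (G.induce {x | x ∉ S}).Preconnected ∨ Fintype.card V ≤ S.card + 1)}

/-- `G` is minimally `k`-connected: `κ(G) = k`, and `κ(G - e) < k` for every edge `e` of `G`. -/
structure IsMinimallyConnected [Fintype V] (G : SimpleGraph V) (k : ℕ) : Prop where
  vertexConnectivity_eq : G.vertexConnectivity = k
  vertexConnectivity_deleteEdges_lt :
    ∀ e ∈ G.edgeSet, (G.deleteEdges {e}).vertexConnectivity < k

end SimpleGraph

/-! Lower bound: a 2-connected graph has no bridge, so by Robbins' theorem it has a strong
orientation, in which every ordered pair contributes at least 1.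

Upper bound: let `S` be the set of vertices of degree at least 3, and let `m` be the number of
edges. Out- and in-degrees bound `κ(u,v) + κ(v,u)` by half of `deg u + deg v`, and by 2 if `u` or
`v` has degree 2. Summing over pairs, the excess over `n(n-1)` is at most `(|S|-1)(m-n)`
(`totalConnectivity_le`). The two factors add up to at most `n-3`
(`card_edgeFinset_add_card_filter_le`), so AM-GM gives `(n-3)²/4`.

The bound on the sum rests on `S` inducing a forest. By minimality each edge `xy` is the only link
across some separation of `G - z`. Along a path in `S` the far sides of these separations are nested
(`IsEdgeSeparation.subset`), so the path cannot return to `x`. -/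

namespace SimpleGraph

/-! ### Nested separations; the branch vertices induce a forest. -/

variable {V : Type*}

/-- `G` has no cut vertex: for every vertex `z`, no proper nonempty part of the remaining
vertices is cut off by `z`. -/
def NoCutVertex (G : SimpleGraph V) : Prop :=
  ∀ (z : V) (B : Set V), B.Nonempty → z ∉ B → (∃ a, a ∉ B ∧ a ≠ z) →
    ∃ a, a ∉ B ∧ a ≠ z ∧ ∃ b ∈ B, G.Adj a b

/-- In `G` without the vertex `z`, the edge from `x` to `y` is the only edge that enters `B`. -/
structure IsEdgeSeparation (G : SimpleGraph V) (x y z : V) (B : Set V) : Prop where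
  left_notMem : x ∉ B
  right_mem : y ∈ B
  sep_notMem : z ∉ B
  sep_ne : z ≠ x
  eq_of_adj : ∀ a, a ∉ B → a ≠ z → ∀ b ∈ B, G.Adj a b → a = x ∧ b = y

/-- Uncrossing: unless the sides are nested, some corner formed by `B`, `B'` and their complements
is attached to the rest through a single vertex, `y` or `z`, which would be a cut vertex. The third
neighbour of `y` excludes the one case where that corner is empty. -/
theorem IsEdgeSeparation.subset {G : SimpleGraph V} (hG : G.NoCutVertex) {x y z v z' : V}
    {B B' : Set V} (h : G.IsEdgeSeparation x y z B) (h' : G.IsEdgeSeparation y v z' B')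
    (hxy : G.Adj x y) (hyv : G.Adj y v) (hvx : v ≠ x)
    (hdeg : ∃ w, G.Adj y w ∧ w ≠ x ∧ w ≠ v) : B' ⊆ B := by
  obtain ⟨hxB, hyB, hzB, hzx, hB⟩ := h
  obtain ⟨hyB', hvB', hzB', hzy, hB'⟩ := h'
  have hxB' : x ∉ B' := by
    intro hx
    exact hvx (hB' y hyB' hzy.symm x hx hxy.symm).2.symm
  have hzy' : z ≠ y := fun e => hzB (e ▸ hyB)
  have hxy' : x ≠ y := hxy.ne
  have hvBz : v ∈ B ∨ v = z := by
    by_contra! hc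
    exact hvx (hB v hc.1 hc.2 y hyB hyv.symm).1
  by_cases hz'B : z' ∈ B
  · by_cases hzC : z ∈ B'
    · exfalso
      obtain ⟨a, ha, hay, b, ⟨hbB, hbB'⟩, hab⟩ := hG y {w | w ∉ B ∧ w ∉ B'} ⟨x, hxB, hxB'⟩
        (fun hc => hc.1 hyB) ⟨z, fun hc => hc.2 hzC, hzy'⟩
      by_cases haB : a ∈ B
      · exact hay (hB b hbB (fun e => hbB' (e ▸ hzC)) a haB hab.symm).2
      · have haB' : a ∈ B' := by
          by_contra hc
          exact ha ⟨haB, hc⟩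
        have := (hB' b hbB' (fun e => hbB (e ▸ hz'B)) a haB' hab.symm).1
        exact hbB (this ▸ hyB)
    · intro c hcB'
      by_contra hcB
      obtain ⟨a, ha, hay, b, ⟨hbB, hbB'⟩, hab⟩ := hG y {w | w ∉ B ∧ w ∈ B'} ⟨c, hcB, hcB'⟩
        (fun hc => hc.1 hyB) ⟨x, fun hc => hxB' hc.2, hxy'⟩
      have hbz : b ≠ z := fun e => hzC (e ▸ hbB')
      by_cases haB : a ∈ B
      · exact hay (hB b hbB hbz a haB hab.symm).2
      · have haB' : a ∉ B' := fun hc => ha ⟨haB, hc⟩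
        exact hay (hB' a haB' (fun e => haB (e ▸ hz'B)) b hbB' hab).1
  by_cases hzz : z' = z
  · subst hzz
    intro c hcB'
    by_contra hcB
    obtain ⟨a, ha, haz, b, ⟨hbB, hbB'⟩, hab⟩ := hG z' {w | w ∉ B ∧ w ∈ B'} ⟨c, hcB, hcB'⟩
      (fun hc => hzB' hc.2) ⟨x, fun hc => hxB' hc.2, hzx.symm⟩
    by_cases haB : a ∈ B
    · exact hxB' ((hB b hbB (fun e => hzB' (e ▸ hbB')) a haB hab.symm).1 ▸ hbB')
    · have haB' : a ∉ B' := fun hc => ha ⟨haB, hc⟩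
      exact haB ((hB' a haB' haz b hbB' hab).1 ▸ hyB)
  -- With `z'` outside `B` and different from `z`, no configuration is possible.
  exfalso
  by_cases hzC : z ∈ B'
  · by_cases hE : ∃ w, w ∈ B ∧ w ∉ B' ∧ w ≠ y
    · obtain ⟨c, hc⟩ := hE
      obtain ⟨a, ha, hay, b, ⟨hbB, hbB', hby⟩, hab⟩ := hG y {w | w ∈ B ∧ w ∉ B' ∧ w ≠ y} ⟨c, hc⟩
        (fun hc => hc.2.2 rfl) ⟨x, fun hc => hxB hc.1, hxy'⟩
      by_cases haz : a ∈ B'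
      · exact hby (hB' b hbB' (fun e => hz'B (e ▸ hbB)) a haz hab.symm).1
      · have haB : a ∉ B := fun hc => ha ⟨hc, haz, hay⟩
        exact hby (hB a haB (fun e => haz (e ▸ hzC)) b hbB hab).2
    -- Here `B` lies in `B'` together with `y`, so a third neighbour of `y` would give a second edge
    -- into `B'`.
    · obtain ⟨w, hyw, hwx, hwv⟩ := hdeg
      have hwB' : w ∈ B' := by
        by_contra hc
        by_cases hwB : w ∈ B
        · exact hE ⟨w, hwB, hc, hyw.ne'⟩
        · exact hwx (hB w hwB (fun e => hc (e ▸ hzC)) y hyB hyw.symm).1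
      exact hwv (hB' y hyB' hzy.symm w hwB' hyw).2
  · have hvB : v ∈ B := hvBz.resolve_right fun e => hzC (e ▸ hvB')
    obtain ⟨a, ha, hay, b, ⟨hbB, hbB'⟩, hab⟩ := hG y {w | w ∈ B ∧ w ∈ B'} ⟨v, hvB, hvB'⟩
      (fun hc => hyB' hc.2) ⟨x, fun hc => hxB hc.1, hxy'⟩
    by_cases haB : a ∈ B
    · have haB' : a ∉ B' := fun hc => ha ⟨haB, hc⟩
      exact hay (hB' a haB' (fun e => hz'B (e ▸ haB)) b hbB' hab).1
    · by_cases haz : a = z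
      · subst haz
        exact hay (hB' a hzC (Ne.symm hzz) b hbB' hab).1
      · exact hyB' ((hB a haB haz b hbB hab).2 ▸ hbB')

/-- Every edge of `G` is separated by some vertex once it is deleted. -/
def EveryEdgeSeparates (G : SimpleGraph V) : Prop :=
  ∀ x y, G.Adj x y → ∃ z B, G.IsEdgeSeparation x y z B

section Finite

variable [Fintype V] (G : SimpleGraph V) [DecidableRel G.Adj]

/-- The vertices of degree at least three. -/
def branchSet : Set V := {v | 3 ≤ G.degree v}

variable {G}

theorem exists_adj_ne_ne {y : V} (hy : 3 ≤ G.degree y) (u v : V) :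
    ∃ w, G.Adj y w ∧ w ≠ u ∧ w ≠ v := by
  classical
  have h : ¬ G.neighborFinset y ⊆ {u, v} := fun h => by
    have h1 := Finset.card_le_card h
    have h2 := Finset.card_le_two (a := u) (b := v)
    rw [card_neighborFinset_eq_degree] at h1
    omega
  obtain ⟨w, hw, hw'⟩ := Finset.not_subset.1 h
  simp only [Finset.mem_insert, Finset.mem_singleton, not_or] at hw'
  exact ⟨w, by simpa using hw, hw'⟩

/-- Each step of the path passes to a smaller side, so its end never leaves the first one. The
vertex `x` may have degree 2; the last condition is then vacuous. -/
theorem mem_of_isPath (hG : G.NoCutVertex) (hE : G.EveryEdgeSeparates) {y w : G.branchSet}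
    (p : (G.induce G.branchSet).Walk y w) (hp : p.IsPath) :
    ∀ (x z : V) (B : Set V), G.Adj x y → G.IsEdgeSeparation x y z B →
      (∀ hx : x ∈ G.branchSet, s(⟨x, hx⟩, y) ∉ p.edges) → (w : V) ∈ B := by
  induction p with
  | nil => exact fun x z B _ h _ => h.right_mem
  | @cons y v w hyv q ih =>
    intro x z B hxy h hx
    rw [Walk.cons_isPath_iff] at hp
    have hyv' : G.Adj (y : V) v := hyv
    have hvx : (v : V) ≠ x := by
      rintro rfl
      refine hx v.2 ?_
      rw [Walk.edges_cons, Sym2.eq_swap]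
      exact List.mem_cons_self
    obtain ⟨z', B', h'⟩ := hE _ _ hyv'
    refine h.subset hG h' hxy hyv' hvx (exists_adj_ne_ne y.2 _ _) (ih hp.1 y z' B' hyv' h' ?_)
    intro hy hmem
    exact hp.2 (q.fst_mem_support_of_mem_edges hmem)

/-- A second route from `y` to `x` would put `x` on the far side of its own edge. -/
theorem isAcyclic_induce_branchSet (hG : G.NoCutVertex) (hE : G.EveryEdgeSeparates) :
    (G.induce G.branchSet).IsAcyclic := by
  classical
  rw [isAcyclic_iff_forall_adj_isBridge]
  intro x y hxy
  have hxy' : G.Adj (x : V) y := hxy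
  obtain ⟨z, B, h⟩ := hE _ _ hxy'
  rw [isBridge_iff]
  rintro ⟨p⟩
  have hle : (G.induce G.branchSet).deleteEdges {s(x, y)} ≤ G.induce G.branchSet :=
    deleteEdges_le _
  refine h.left_notMem (mem_of_isPath hG hE
    (p.reverse.toPath.1.mapLe hle) (p.reverse.toPath.2.mapLe hle) x z B hxy' h ?_)
  intro _ hmem
  rw [Walk.edges_mapLe_eq_edges] at hmem
  have := Walk.edges_subset_edgeSet _ hmem
  simp [edgeSet_deleteEdges] at this

theorem not_reachable_of_degree_eq_two (hG : G.NoCutVertex) (hE : G.EveryEdgeSeparates)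
    {d : V} {a b : G.branchSet} (hab : a ≠ b) (hd : G.degree d ≤ 2) (ha : G.Adj d a)
    (hN : ∀ w, G.Adj d w → w = a ∨ w = b) : ¬ (G.induce G.branchSet).Reachable a b := by
  classical
  rintro ⟨p⟩
  have hda : (a : V) ≠ d := ha.ne'
  have hdb : (b : V) ≠ d := by
    intro e
    have := b.2
    rw [e] at this
    simp only [branchSet, Set.mem_ofPred_eq] at this
    omega
  have hab' : (a : V) ≠ b := fun e => hab (Subtype.ext e)
  -- Once `b` is removed, `da` is the only edge at `d`. A path from `a` to `b` would force `b` into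
  -- this side.
  have h : G.IsEdgeSeparation d a b {w | w ≠ d ∧ w ≠ b} := by
    refine ⟨by simp, ⟨hda, hab'⟩, by simp, hdb, ?_⟩
    intro c hc hcb w hw hcw
    have hcd : c = d := by
      by_contra hne
      exact hc ⟨hne, hcb⟩
    subst hcd
    exact ⟨rfl, (hN w hcw).resolve_right hw.2⟩
  refine (mem_of_isPath hG hE p.toPath.1 p.toPath.2 d b _ ha h ?_).2 rfl
  intro hd'
  simp only [branchSet, Set.mem_ofPred_eq] at hd'
  omega

end Finite

end SimpleGraph

/-! ### Counting edges against branch vertices. -/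

namespace SimpleGraph

theorem IsAcyclic.card_edgeFinset_add_one_le {W : Type*} [Fintype W] [Nonempty W]
    {H : SimpleGraph W} [Fintype H.edgeSet] (h : H.IsAcyclic) :
    H.edgeFinset.card + 1 ≤ Fintype.card W := by
  classical
  obtain ⟨T, hHT, -, hT⟩ := connected_top.exists_isTree_le_of_le_of_isAcyclic le_top h
  rw [← hT.card_edgeFinset]
  exact Nat.succ_le_succ (Finset.card_le_card (edgeFinset_mono hHT))

/-- Joining `a` to `b` gives a forest with one more edge. -/
theorem IsAcyclic.card_edgeFinset_add_two_le {W : Type*} [Fintype W]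
    {H : SimpleGraph W} [Fintype H.edgeSet] (h : H.IsAcyclic) {a b : W}
    (hab : ¬ H.Reachable a b) : H.edgeFinset.card + 2 ≤ Fintype.card W := by
  classical
  have : Nonempty W := ⟨a⟩
  have hne : a ≠ b := by
    rintro rfl
    exact hab (Reachable.refl a)
  have hlt : H < H ⊔ edge a b := by
    refine lt_of_le_of_ne le_sup_left fun he => hab ?_
    have : (H ⊔ edge a b).Adj a b := Or.inr (by simp [edge_adj, hne])
    rw [← he] at this
    exact this.reachable
  have h1 := (h.sup_edge_of_not_reachable hab).card_edgeFinset_add_one_le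
  have h2 := Finset.card_lt_card (edgeFinset_strict_mono hlt)
  omega

variable {V : Type*} [Fintype V] {G : SimpleGraph V} [DecidableRel G.Adj]

/-- In a graph without cut vertices that is edge-minimal with this property, the number of edges
and the number of vertices of degree at least three satisfy a joint linear bound. -/
theorem card_edgeFinset_add_card_filter_le (hG : G.NoCutVertex) (hE : G.EveryEdgeSeparates)
    (hdeg : ∀ v, 2 ≤ G.degree v) (hV : 3 ≤ Fintype.card V) :
    G.edgeFinset.card + (Finset.univ.filter fun v => 3 ≤ G.degree v).card + 2
      ≤ 2 * Fintype.card V := by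
  classical
  set S : Finset V := Finset.univ.filter fun v => 3 ≤ G.degree v with hS
  have hmem : ∀ v, v ∈ S ↔ 3 ≤ G.degree v := by simp [hS]
  have htwo : ∀ v, v ∉ S → G.degree v = 2 := fun v hv => by
    have := hdeg v
    rw [hmem] at hv
    omega
  have hdegsum : ∀ v, G.degree v = (∑ w ∈ S, if G.Adj v w then 1 else 0)
      + ∑ w ∈ Sᶜ, if G.Adj v w then 1 else 0 := by
    intro v
    rw [Finset.sum_add_sum_compl, ← Finset.card_filter, ← card_neighborFinset_eq_degree,
      neighborFinset_eq_filter]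
  have hsum := G.sum_degrees_eq_twice_card_edges
  rw [← Finset.sum_add_sum_compl S, Finset.sum_congr rfl fun v _ => hdegsum v,
    Finset.sum_add_distrib,
    Finset.sum_congr rfl fun v hv => htwo v (Finset.mem_compl.1 hv), Finset.sum_const,
    smul_eq_mul] at hsum
  have hinner : ∑ v ∈ S, ∑ w ∈ S, (if G.Adj v w then 1 else 0)
      = 2 * (G.induce G.branchSet).edgeFinset.card := by
    rw [← sum_degrees_eq_twice_card_edges]
    have hsub : ∀ f : V → ℕ, ∑ v ∈ S, f v = ∑ v : G.branchSet, f v := fun f =>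
      Finset.sum_subtype S (fun v => hmem v) f
    rw [hsub]
    refine Finset.sum_congr rfl fun v _ => ?_
    rw [hsub, ← card_neighborFinset_eq_degree, neighborFinset_eq_filter, Finset.card_filter]
    rfl
  have hmem' : ∀ v, v ∈ S ↔ v ∈ G.branchSet := hmem
  have hcardS : Fintype.card G.branchSet = S.card := Fintype.card_of_subtype S hmem'
  have hcompl : Sᶜ.card + S.card = Fintype.card V := by
    have := S.card_add_card_compl
    omega
  have hcross : ∀ w ∈ Sᶜ, (∑ v ∈ S, if G.Adj w v then 1 else 0) ≤ 2 := fun w hw => by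
    have h1 := htwo w (Finset.mem_compl.1 hw)
    have h2 := hdegsum w
    omega
  have hswap : ∑ v ∈ S, ∑ w ∈ Sᶜ, (if G.Adj v w then 1 else 0)
      = ∑ w ∈ Sᶜ, ∑ v ∈ S, (if G.Adj w v then 1 else 0) := by
    rw [Finset.sum_comm]
    simp only [G.adj_comm]
  rw [hinner, hswap] at hsum
  have hle := Finset.sum_le_sum hcross
  rw [Finset.sum_const, smul_eq_mul] at hle
  rcases S.eq_empty_or_nonempty with hemp | ⟨r, hr⟩
  · have hS0 : S.card = 0 := by rw [hemp, Finset.card_empty]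
    have := Fintype.card_eq_zero_iff.1 (hcardS.trans hS0)
    have : (G.induce G.branchSet).edgeFinset.card = 0 := by
      rw [Finset.card_eq_zero, Finset.eq_empty_iff_forall_notMem]
      intro e
      induction e with | _ a b => exact isEmptyElim a
    have hz : ∑ w ∈ Sᶜ, ∑ v ∈ S, (if G.Adj w v then 1 else 0) = 0 := by simp [hemp]
    omega
  have : Nonempty G.branchSet := ⟨⟨r, (hmem r).1 hr⟩⟩
  -- The degree sum and the forest bound alone give `m + |S| + 1 ≤ 2n`. The missing 1 comes from the
  -- crossing edges or from the forest, according to whether two vertices of degree 2 are adjacent.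
  have hac := isAcyclic_induce_branchSet hG hE
  have hone := hac.card_edgeFinset_add_one_le
  by_cases hD : ∃ d ∈ Sᶜ, ∃ d' ∈ Sᶜ, G.Adj d d'
  · obtain ⟨d, hd, d', hd', hdd⟩ := hD
    have hlt : (∑ v ∈ S, if G.Adj d v then 1 else 0) < 2 := by
      have h1 := htwo d (Finset.mem_compl.1 hd)
      have h2 := hdegsum d
      have h3 : 1 ≤ ∑ w ∈ Sᶜ, if G.Adj d w then 1 else 0 := by
        refine le_trans ?_ (Finset.single_le_sum (fun _ _ => Nat.zero_le _) hd')
        rw [if_pos hdd]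
      omega
    -- Losing one crossing edge is enough, by parity in the degree sum.
    have hlt' := Finset.sum_lt_sum hcross ⟨d, hd, hlt⟩
    rw [Finset.sum_const, smul_eq_mul] at hlt'
    omega
  · push Not at hD
    have hne : Sᶜ.Nonempty := by
      rw [Finset.nonempty_iff_ne_empty]
      intro h0
      have hz : ∑ w ∈ Sᶜ, ∑ v ∈ S, (if G.Adj w v then 1 else 0) = 0 := by simp [h0]
      have h2m := G.sum_degrees_eq_twice_card_edges
      have h2n := Finset.sum_le_sum fun v (_ : v ∈ Finset.univ) => hdeg v
      rw [Finset.sum_const, smul_eq_mul, Finset.card_univ] at h2n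
      have hS0 : Sᶜ.card = 0 := by rw [h0, Finset.card_empty]
      omega
    obtain ⟨d, hd⟩ := hne
    -- Both neighbours of `d` are branch vertices in different components, so the forest is not a
    -- tree.
    have hd2 := htwo d (Finset.mem_compl.1 hd)
    obtain ⟨a, b, hab, hN⟩ := Finset.card_eq_two.1 ((card_neighborFinset_eq_degree G d).trans hd2)
    have hN' : ∀ w, G.Adj d w ↔ w = a ∨ w = b := fun w => by
      rw [← mem_neighborFinset, hN]
      simp
    have hS' : ∀ w, G.Adj d w → w ∈ G.branchSet := fun w hw => by
      by_contra hc
      exact hD d hd w (Finset.mem_compl.2 fun h => hc ((hmem w).1 h)) hw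
    have hnr := not_reachable_of_degree_eq_two hG hE
      (a := ⟨a, hS' a ((hN' a).2 (Or.inl rfl))⟩) (b := ⟨b, hS' b ((hN' b).2 (Or.inr rfl))⟩)
      (fun e => hab (congrArg Subtype.val e)) hd2.le ((hN' a).2 (Or.inl rfl))
      (fun w hw => (hN' w).1 hw)
    have := hac.card_edgeFinset_add_two_le hnr
    omega

end SimpleGraph

/-! ### From vertex connectivity to cut vertices and edge separations. -/

namespace SimpleGraph

variable {V : Type*} [Fintype V] {G : SimpleGraph V}

/-- A type with at least three elements has one different from two given ones. -/
theorem exists_ne_ne_of_three_le_card (hV : 3 ≤ Fintype.card V) (u v : V) :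
    ∃ w, w ≠ u ∧ w ≠ v := by
  classical
  obtain ⟨w, hw⟩ := Finset.exists_mem_notMem_of_card_lt_card (s := {u, v}) (t := Finset.univ)
    (by rw [Finset.card_univ]; exact lt_of_le_of_lt Finset.card_le_two hV)
  exact ⟨w, by simpa using hw⟩

theorem vertexConnectivity_le_iff {k : ℕ} :
    G.vertexConnectivity ≤ k ↔ ∃ S : Finset V, S.card ≤ k ∧
      (¬ (G.induce {x | x ∉ S}).Preconnected ∨ Fintype.card V ≤ S.card + 1) := by
  have hne : {k | ∃ S : Finset V, S.card = k ∧
      (¬ (G.induce {x | x ∉ S}).Preconnected ∨ Fintype.card V ≤ S.card + 1)}.Nonempty :=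
    ⟨_, Finset.univ, rfl, Or.inr (Nat.le_succ _)⟩
  constructor
  · intro h
    obtain ⟨S, hS, h'⟩ := Nat.sInf_mem hne
    exact ⟨S, hS.trans_le h, h'⟩
  · rintro ⟨S, hS, h'⟩
    have : G.vertexConnectivity ≤ S.card := Nat.sInf_le ⟨S, rfl, h'⟩
    exact this.trans hS

theorem noCutVertex_of_two_le (h : 2 ≤ G.vertexConnectivity) : G.NoCutVertex := by
  intro z B hB hz ha
  obtain ⟨b, hb⟩ := hB
  obtain ⟨a, haB, haz⟩ := ha
  have hc : (G.induce {x | x ∉ ({z} : Finset V)}).Preconnected := by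
    by_contra hc
    have := vertexConnectivity_le_iff.2 ⟨{z}, (Finset.card_singleton z).le, Or.inl hc⟩
    omega
  have hbz : b ≠ z := fun e => hz (e ▸ hb)
  obtain ⟨p⟩ := hc ⟨b, by simpa using hbz⟩ ⟨a, by simpa using haz⟩
  obtain ⟨d, -, hd1, hd2⟩ := p.exists_boundary_dart {x | (x : V) ∈ B} hb haB
  exact ⟨d.snd, hd2, by simpa using d.snd.2, d.fst, hd1, d.adj.symm⟩

theorem NoCutVertex.preconnected (hG : G.NoCutVertex) (hV : 3 ≤ Fintype.card V) :
    G.Preconnected := by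
  intro u v
  obtain ⟨z, hz⟩ := exists_ne_ne_of_three_le_card hV u v
  by_contra huv
  obtain ⟨a, ha, haz, b, ⟨hb, -⟩, hab⟩ := hG z {w | G.Reachable u w ∧ w ≠ z}
    ⟨u, Reachable.refl u, Ne.symm hz.1⟩ (fun h => h.2 rfl) ⟨v, fun h => huv h.1, Ne.symm hz.2⟩
  exact ha ⟨hb.trans hab.symm.reachable, haz⟩

/-- An edge between two sides of a partition is not the only one. -/
theorem NoCutVertex.exists_adj_ne (hG : G.NoCutVertex) (hV : 3 ≤ Fintype.card V) {x y : V}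
    (B : Set V) (hx : x ∉ B) (hy : y ∈ B) :
    ∃ a, a ∉ B ∧ ∃ b ∈ B, G.Adj a b ∧ ¬ (a = x ∧ b = y) := by
  obtain ⟨w, hw⟩ := exists_ne_ne_of_three_le_card hV x y
  by_cases hwB : w ∈ B
  · obtain ⟨a, ha, hay, b, ⟨hb, hb'⟩, hab⟩ := hG y {v | v ∈ B ∧ v ≠ y} ⟨w, hwB, hw.2⟩
      (fun h => h.2 rfl) ⟨x, fun h => hx h.1, fun e => hx (e ▸ hy)⟩
    exact ⟨a, fun h => ha ⟨h, hay⟩, b, hb, hab, fun h => hb' h.2⟩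
  · obtain ⟨a, ha, hax, b, hb, hab⟩ := hG x B ⟨y, hy⟩ hx ⟨w, hwB, hw.1⟩
    exact ⟨a, ha, b, hb, hab, fun h => hax h.1⟩

theorem NoCutVertex.two_le_degree [DecidableRel G.Adj] (hG : G.NoCutVertex)
    (hV : 3 ≤ Fintype.card V) (v : V) : 2 ≤ G.degree v := by
  classical
  have hnbr : ∀ z, z ≠ v → ∃ a, a ≠ z ∧ G.Adj v a := fun z hz => by
    obtain ⟨w, hwv, hwz⟩ := exists_ne_ne_of_three_le_card hV v z
    obtain ⟨a, -, haz, b, rfl, hab⟩ := hG z {v} ⟨v, rfl⟩ hz ⟨w, hwv, hwz⟩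
    exact ⟨a, haz, hab.symm⟩
  obtain ⟨z, hz, -⟩ := exists_ne_ne_of_three_le_card hV v v
  obtain ⟨a, -, ha⟩ := hnbr z hz
  obtain ⟨b, hba, hb⟩ := hnbr a ha.ne'
  rw [← card_neighborFinset_eq_degree, ← Finset.card_pair hba]
  refine Finset.card_le_card fun w hw => ?_
  rw [Finset.mem_insert, Finset.mem_singleton] at hw
  rw [mem_neighborFinset]
  rcases hw with rfl | rfl
  · exact hb
  · exact ha

/-- A separator of `G - e` has at most one vertex. It is not empty, since `e` is no bridge, and
since its vertex does not cut `G`, the edge `e` must cross between the parts. -/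
theorem everyEdgeSeparates_of_lt (hG : G.NoCutVertex) (hV : 3 ≤ Fintype.card V)
    (h : ∀ e ∈ G.edgeSet, (G.deleteEdges {e}).vertexConnectivity < 2) :
    G.EveryEdgeSeparates := by
  intro x y hxy
  obtain ⟨S, hS, hS'⟩ := vertexConnectivity_le_iff.1 (Nat.le_of_lt_succ (h s(x, y) hxy))
  have hpre := hS'.resolve_right (by omega)
  unfold Preconnected at hpre
  push Not at hpre
  obtain ⟨u, v, huv⟩ := hpre
  set H := (G.deleteEdges {s(x, y)}).induce {w | w ∉ S} with hH
  set C : Set V := {w | ∃ hw : w ∉ S, H.Reachable v ⟨w, hw⟩} with hC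
  have hCadj : ∀ a, a ∉ C → a ∉ S → ∀ b ∈ C, G.Adj a b → s(a, b) = s(x, y) := by
    rintro a haC haS b ⟨hbS, hb⟩ hab
    by_contra hne
    refine haC ⟨haS, hb.trans (Adj.reachable ?_)⟩
    rw [hH, comap_adj, deleteEdges_adj]
    exact ⟨hab.symm, fun he => hne (Sym2.eq_swap.trans he)⟩
  have hvC : (v : V) ∈ C := ⟨v.2, Reachable.refl _⟩
  have huC : (u : V) ∉ C := fun ⟨_, hu⟩ => huv hu.symm
  rcases Nat.le_one_iff_eq_zero_or_eq_one.1 hS with h0 | h1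
  · exfalso
    rw [Finset.card_eq_zero] at h0
    have hCadj' : ∀ a, a ∉ C → ∀ b ∈ C, G.Adj a b → s(a, b) = s(x, y) := fun a ha =>
      hCadj a ha (by simp [h0])
    obtain ⟨a, ha, b, hb, hab, -⟩ := hG.exists_adj_ne hV C huC hvC
    -- Two different crossing edges cannot both be `xy`.
    obtain ⟨a', ha', b', hb', hab', hne⟩ := hG.exists_adj_ne hV C ha hb
    have he := (hCadj' a' ha' b' hb' hab').trans (hCadj' a ha b hb hab).symm
    rcases Sym2.eq_iff.1 he with he | he
    · exact hne he
    · exact ha' (he.1 ▸ hb)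
  · obtain ⟨z, rfl⟩ := Finset.card_eq_one.1 h1
    have hzC : z ∉ C := fun ⟨hz, _⟩ => hz (Finset.mem_singleton_self z)
    have hCadj' : ∀ a, a ∉ C → a ≠ z → ∀ b ∈ C, G.Adj a b → s(a, b) = s(x, y) :=
      fun a ha haz => hCadj a ha (by simpa using haz)
    obtain ⟨a, ha, haz, b, hb, hab⟩ := hG z C ⟨v, hvC⟩ hzC ⟨u, huC, by simpa using u.2⟩
    rcases Sym2.eq_iff.1 (hCadj' a ha haz b hb hab) with ⟨rfl, rfl⟩ | ⟨rfl, rfl⟩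
    · refine ⟨z, C, ha, hb, hzC, haz.symm, fun c hc hcz d hd hcd => ?_⟩
      rcases Sym2.eq_iff.1 (hCadj' c hc hcz d hd hcd) with he | he
      · exact he
      · exact absurd (he.1 ▸ hb) hc
    -- The component contains `x` instead of `y`, so the opposite side serves.
    · refine ⟨z, {w | w ∉ C ∧ w ≠ z}, fun hc => hc.1 hb, ⟨ha, haz⟩, fun hc => hc.2 rfl,
        fun e => hzC (e ▸ hb), fun c hc hcz d hd hcd => ?_⟩
      have hcC : c ∈ C := by
        by_contra hcC
        exact hc ⟨hcC, hcz⟩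
      rcases Sym2.eq_iff.1 (hCadj' d hd.1 hd.2 c hcC hcd.symm) with he | he
      · exact absurd (he.1 ▸ hb) hd.1
      · exact he.symm

end SimpleGraph

/-! ### Strong orientations. -/

namespace SimpleGraph

variable {V : Type*}

/-- Robbins' theorem: a graph that stays connected when an edge is deleted has a strongly
connected orientation. -/
theorem exists_orientation_reflTransGen [Finite V] {G : SimpleGraph V} (hconn : G.Preconnected)
    (hbr : ∀ (B : Set V) (x y : V), x ∉ B → y ∈ B →
      ∃ a, a ∉ B ∧ ∃ b ∈ B, G.Adj a b ∧ ¬ (a = x ∧ b = y)) :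
    ∃ D : Digraph V, D.IsOrientationOf G ∧ ∀ u v, Relation.ReflTransGen D.Adj u v := by
  -- Starting from both directions on every edge, take a minimal strongly connected relation that
  -- still covers `G`; it turns out to be asymmetric.
  obtain ⟨M, ⟨hsym, hstrong⟩, hmin⟩ := exists_minimal_of_wellFoundedLT
    (fun M : V → V → Prop => (∀ u v, G.Adj u v ↔ M u v ∨ M v u) ∧
      ∀ u v, Relation.ReflTransGen M u v)
    ⟨G.Adj, fun u v => by rw [G.adj_comm v u, or_self], fun u v => by
      rw [← reachable_iff_reflTransGen]
      exact hconn u v⟩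
  refine ⟨⟨M⟩, ⟨hsym, fun u v huv hvu => ?_⟩, hstrong⟩
  have hne : u ≠ v := ((hsym u v).2 (Or.inl huv)).ne
  -- Deleting one of the two arcs between `p` and `q` destroys strong connectivity.
  have hdel : ∀ p q, M p q → M q p → p ≠ q →
      ¬ Relation.ReflTransGen (fun a b => M a b ∧ ¬ (a = p ∧ b = q)) p q := by
    intro p q hpq hqp hpne hreach
    refine (hmin (y := fun a b => M a b ∧ ¬ (a = p ∧ b = q)) ⟨fun a b => ?_, fun a b => ?_⟩
      (fun a b h => h.1) p q hpq).2 ⟨rfl, rfl⟩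
    · rw [hsym]
      constructor
      · rintro (h | h)
        · by_cases he : a = p ∧ b = q
          · obtain ⟨rfl, rfl⟩ := he
            exact Or.inr ⟨hqp, fun h => hpne h.2⟩
          · exact Or.inl ⟨h, he⟩
        · by_cases he : b = p ∧ a = q
          · obtain ⟨rfl, rfl⟩ := he
            exact Or.inl ⟨hqp, fun h => hpne h.2⟩
          · exact Or.inr ⟨h, he⟩
      · exact Or.imp And.left And.left
    · induction hstrong a b with
      | refl => exact Relation.ReflTransGen.refl
      | @tail c d _ hcd ih =>
        by_cases he : c = p ∧ d = q
        · obtain ⟨rfl, rfl⟩ := he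
          exact ih.trans hreach
        · exact ih.tail ⟨hcd, he⟩
  set N : V → V → Prop := fun a b => M a b ∧ ¬ (a = u ∧ b = v) ∧ ¬ (a = v ∧ b = u) with hN
  have huv' : ¬ Relation.ReflTransGen N u v := fun h =>
    hdel u v huv hvu hne (Relation.ReflTransGen.mono (fun _ _ h => ⟨h.1, h.2.1⟩) _ _ h)
  have hvu' : ¬ Relation.ReflTransGen N v u := fun h =>
    hdel v u hvu huv hne.symm (Relation.ReflTransGen.mono (fun _ _ h => ⟨h.1, h.2.2⟩) _ _ h)
  have hcover : ∀ w, Relation.ReflTransGen N u w ∨ Relation.ReflTransGen N v w := by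
    intro w
    induction hstrong u w with
    | refl => exact Or.inl Relation.ReflTransGen.refl
    | @tail c d _ hcd ih =>
      by_cases h1 : c = u ∧ d = v
      · exact Or.inr (h1.2 ▸ Relation.ReflTransGen.refl)
      by_cases h2 : c = v ∧ d = u
      · exact Or.inl (h2.2 ▸ Relation.ReflTransGen.refl)
      exact ih.imp (fun h => h.tail ⟨hcd, h1, h2⟩) (fun h => h.tail ⟨hcd, h1, h2⟩)
  have hback : ∀ w, Relation.ReflTransGen N w u ∨ Relation.ReflTransGen N w v := by
    intro w
    induction hstrong w u using Relation.ReflTransGen.head_induction_on with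
    | refl => exact Or.inl Relation.ReflTransGen.refl
    | @head c d hcd _ ih =>
      by_cases h1 : c = u ∧ d = v
      · exact Or.inl (h1.1 ▸ Relation.ReflTransGen.refl)
      by_cases h2 : c = v ∧ d = u
      · exact Or.inr (h2.1 ▸ Relation.ReflTransGen.refl)
      exact ih.imp (fun h => h.head ⟨hcd, h1, h2⟩) (fun h => h.head ⟨hcd, h1, h2⟩)
  -- Without the two arcs, the sets reachable from `u` and from `v` partition the vertices. Any
  -- further edge between them, in either direction, contradicts this.
  have hdisj : ∀ w, Relation.ReflTransGen N u w → ¬ Relation.ReflTransGen N v w := by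
    intro w hu hv
    rcases hback w with h | h
    · exact hvu' (hv.trans h)
    · exact huv' (hu.trans h)
  obtain ⟨a, ha, b, hb, hab, hne'⟩ := hbr {w | Relation.ReflTransGen N v w} u v hvu'
    Relation.ReflTransGen.refl
  have hau := (hcover a).resolve_right ha
  rcases (hsym a b).1 hab with h | h
  · refine hdisj b (hau.tail ⟨h, hne', fun he => ?_⟩) hb
    exact hdisj u Relation.ReflTransGen.refl (he.2 ▸ hb)
  · refine ha (Relation.ReflTransGen.tail hb ⟨h, fun he => ?_, fun he => hne' ⟨he.2, he.1⟩⟩)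
    exact hdisj u Relation.ReflTransGen.refl (he.1 ▸ hb)

end SimpleGraph

/-! ### Degree bounds for the connectivity of a pair. -/

namespace Digraph

variable {V : Type*} {D : Digraph V} {u v : V}

theorem exists_isDirPath_of_reflTransGen (h : Relation.ReflTransGen D.Adj u v) :
    ∃ l, D.IsDirPath u v l := by
  induction h using Relation.ReflTransGen.head_induction_on with
  | refl => exact ⟨[v], by simp, by simp, rfl, rfl⟩
  | @head a b hab _ ih =>
    obtain ⟨l, hnd, hch, hhd, hlast⟩ := ih
    by_cases ha : a ∈ l
    · obtain ⟨s, t, rfl⟩ := List.append_of_mem ha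
      refine ⟨a :: t, (List.nodup_append.1 hnd).2.1, hch.right_of_append, rfl, ?_⟩
      rwa [List.getLast?_append_of_ne_nil _ (List.cons_ne_nil _ _)] at hlast
    · refine ⟨a :: l, List.nodup_cons.2 ⟨ha, hnd⟩, ?_, rfl, ?_⟩
      · rw [List.isChain_cons]
        refine ⟨fun y hy => ?_, hch⟩
        rw [hhd] at hy
        cases hy
        exact hab
      · cases l with
        | nil => cases hhd
        | cons c l => rwa [List.getLast?_cons_cons]

theorem IsDirPath.exists_eq_cons_cons {l : List V} (h : D.IsDirPath u v l) (huv : u ≠ v) :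
    ∃ w t, l = u :: w :: t ∧ D.Adj u w ∧ (w = v → t = []) := by
  obtain ⟨hnd, hch, hhd, hlast⟩ := h
  match l, hhd with
  | [_], rfl => exact absurd (by simpa using hlast) huv
  | _ :: w :: t, rfl =>
    refine ⟨w, t, rfl, (List.isChain_cons_cons.1 hch).1, ?_⟩
    rintro rfl
    by_contra ht
    rw [List.getLast?_cons_cons, List.getLast?_cons_of_ne_nil ht] at hlast
    exact (List.nodup_cons.1 (List.nodup_cons.1 hnd).2).1 (List.mem_of_getLast? hlast)

variable [Fintype V]

theorem one_le_pathConnectivity (h : Relation.ReflTransGen D.Adj u v) :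
    1 ≤ D.pathConnectivity u v := by
  obtain ⟨l, hl⟩ := exists_isDirPath_of_reflTransGen h
  refine (D.isGreatest_pathConnectivity u v).2 ⟨{l}, ⟨?_, ?_⟩, Finset.card_singleton l⟩
  · simpa using hl
  · intro a ha b hb hab
    rw [Finset.mem_singleton] at ha hb
    exact absurd (ha.trans hb.symm) hab

/-- Disjoint paths have different second vertices: a common one could only be `v`, and then both
paths are the single arc. -/
theorem pathConnectivity_le_out (huv : u ≠ v) [DecidablePred (D.Adj u)] :
    D.pathConnectivity u v ≤ (Finset.univ.filter (D.Adj u)).card := by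
  obtain ⟨P, hP, hcard⟩ := (D.isGreatest_pathConnectivity u v).1
  rw [← hcard]
  have hex : ∀ l ∈ P, ∃ w t, l = u :: w :: t ∧ D.Adj u w ∧ (w = v → t = []) := fun l hl =>
    (hP.isDirPath l hl).exists_eq_cons_cons huv
  have : Nonempty V := ⟨u⟩
  choose! f t hf using hex
  refine Finset.card_le_card_of_injOn f (fun l hl => by simpa using (hf l hl).2.1) ?_
  intro l hl m hm hlm
  by_contra hne
  obtain ⟨hl1, -, hl3⟩ := hf l hl
  obtain ⟨hm1, -, hm3⟩ := hf m hm
  have hmem : f l ∈ u :: f l :: t l := by simp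
  have hmem' : f m ∈ u :: f m :: t m := by simp
  rw [← hl1] at hmem
  rw [← hm1, ← hlm] at hmem'
  rcases hP.disjoint l hl m hm hne _ hmem hmem' with he | he
  · have hnd := (hP.isDirPath l hl).nodup
    rw [hl1, he] at hnd
    simp at hnd
  · exact hne (by rw [hl1, hm1, ← hlm, hl3 he, hm3 (hlm ▸ he)])

/-- Reversing the paths turns the out-degree bound into the in-degree bound. -/
theorem pathConnectivity_le_flip :
    D.pathConnectivity u v ≤ (⟨fun a b => D.Adj b a⟩ : Digraph V).pathConnectivity v u := by
  classical
  obtain ⟨P, hP, hcard⟩ := (D.isGreatest_pathConnectivity u v).1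
  refine (isGreatest_pathConnectivity _ v u).2 ⟨P.image List.reverse, ⟨?_, ?_⟩, ?_⟩
  · intro l hl
    obtain ⟨m, hm, rfl⟩ := Finset.mem_image.1 hl
    obtain ⟨hnd, hch, hhd, hlast⟩ := hP.isDirPath m hm
    exact ⟨List.nodup_reverse.2 hnd, List.isChain_reverse.2 hch, by simpa using hlast,
      by simpa using hhd⟩
  · intro l hl l' hl' hne x hx hx'
    obtain ⟨m, hm, rfl⟩ := Finset.mem_image.1 hl
    obtain ⟨m', hm', rfl⟩ := Finset.mem_image.1 hl'
    exact (hP.disjoint m hm m' hm' (fun e => hne (e ▸ rfl)) x (List.mem_reverse.1 hx)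
      (List.mem_reverse.1 hx')).symm
  · rw [Finset.card_image_of_injective _ List.reverse_injective, hcard]

theorem pathConnectivity_le_in (huv : u ≠ v) [DecidablePred fun a => D.Adj a v] :
    D.pathConnectivity u v ≤ (Finset.univ.filter fun a => D.Adj a v).card :=
  pathConnectivity_le_flip.trans
    (pathConnectivity_le_out (D := ⟨fun a b => D.Adj b a⟩) huv.symm)

theorem IsOrientationOf.card_out_add_card_in [DecidableRel D.Adj] {G : SimpleGraph V}
    [DecidableRel G.Adj] (h : D.IsOrientationOf G) (v : V) :
    (Finset.univ.filter (D.Adj v)).card + (Finset.univ.filter fun a => D.Adj a v).card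
      = G.degree v := by
  classical
  rw [← Finset.card_union_of_disjoint, ← SimpleGraph.card_neighborFinset_eq_degree,
    SimpleGraph.neighborFinset_eq_filter]
  · congr 1
    ext w
    simp [h.adj_iff v w]
  · rw [Finset.disjoint_left]
    intro w hw hw'
    exact h.asymm v w (by simpa using hw) (by simpa using hw')

end Digraph

/-! ### Summation over all pairs. -/

namespace Digraph

variable {V : Type*} [Fintype V]

theorem IsOrientationOf.totalConnectivity_le {G : SimpleGraph V} [DecidableRel G.Adj]
    {D : Digraph V} (h : D.IsOrientationOf G) (hdeg : ∀ v, 2 ≤ G.degree v) :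
    (D.totalConnectivity : ℤ) ≤ Fintype.card V * (Fintype.card V - 1) +
      (((Finset.univ.filter fun v => 3 ≤ G.degree v).card : ℤ) - 1) *
        (G.edgeFinset.card - Fintype.card V) := by
  classical
  set S : Finset V := Finset.univ.filter fun v => 3 ≤ G.degree v with hS
  have hmem : ∀ v, v ∈ S ↔ 3 ≤ G.degree v := by simp [hS]
  set κ : V → V → ℤ := fun u v => D.pathConnectivity u v with hκ
  -- Doubling avoids halves. The four degree bounds add up to `deg u + deg v`; if one of the
  -- vertices has degree 2, its own out- and in-degree already give the bound 4.
  have hpair : ∀ u v, u ≠ v → 2 * κ u v + 2 * κ v u ≤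
      4 + if u ∈ S ∧ v ∈ S then ((G.degree u : ℤ) - 2) + ((G.degree v : ℤ) - 2) else 0 := by
    intro u v huv
    have h1 := D.pathConnectivity_le_out huv
    have h2 := D.pathConnectivity_le_in huv
    have h3 := D.pathConnectivity_le_out huv.symm
    have h4 := D.pathConnectivity_le_in huv.symm
    have h5 := h.card_out_add_card_in u
    have h6 := h.card_out_add_card_in v
    have h7 := hdeg u
    have h8 := hdeg v
    simp only [hmem, hκ]
    split_ifs with hc
    · omega
    · rw [not_and_or] at hc
      omega
  have hoff : ∀ (T : Finset V) (g : V → ℤ),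
      ∑ p ∈ T.offDiag, (g p.1 + g p.2) = 2 * ((T.card : ℤ) - 1) * ∑ v ∈ T, g v := by
    intro T g
    have hdiag : ∑ p ∈ T.diag, (g p.1 + g p.2) = 2 * ∑ v ∈ T, g v := by
      rw [Finset.sum_diag, Finset.mul_sum]
      exact Finset.sum_congr rfl fun v _ => (two_mul _).symm
    have hall : ∑ p ∈ T ×ˢ T, (g p.1 + g p.2) = 2 * (T.card : ℤ) * ∑ v ∈ T, g v := by
      rw [Finset.sum_product]
      simp only [Finset.sum_add_distrib, Finset.sum_const, nsmul_eq_mul, ← Finset.mul_sum]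
      ring
    rw [← Finset.diag_union_offDiag, Finset.sum_union (Finset.disjoint_diag_offDiag T),
      hdiag] at hall
    linear_combination hall
  have hswap : ∑ p ∈ (Finset.univ : Finset V).offDiag, κ p.2 p.1
      = ∑ p ∈ (Finset.univ : Finset V).offDiag, κ p.1 p.2 := by
    refine Finset.sum_nbij' Prod.swap Prod.swap ?_ ?_ ?_ ?_ ?_ <;> simp [eq_comm]
  have hK : (D.totalConnectivity : ℤ) = ∑ p ∈ (Finset.univ : Finset V).offDiag, κ p.1 p.2 := by
    unfold totalConnectivity
    rw [Nat.cast_sum]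
  have hsum := Finset.sum_le_sum fun p (hp : p ∈ (Finset.univ : Finset V).offDiag) =>
    hpair p.1 p.2 (Finset.mem_offDiag.1 hp).2.2
  have hfilter : (Finset.univ : Finset V).offDiag.filter (fun p => p.1 ∈ S ∧ p.2 ∈ S)
      = S.offDiag := by
    ext p
    simp only [Finset.mem_filter, Finset.mem_offDiag, Finset.mem_univ, true_and]
    tauto
  have hfour := hoff Finset.univ fun _ => 2
  -- Vertices outside `S` have no excess degree, so the sum may run over all vertices.
  have hdegsum : ∑ v ∈ S, ((G.degree v : ℤ) - 2) = 2 * (G.edgeFinset.card - Fintype.card V) := by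
    have h1 : ∑ v ∈ S, ((G.degree v : ℤ) - 2) = ∑ v, ((G.degree v : ℤ) - 2) := by
      refine Finset.sum_subset (Finset.subset_univ S) fun v _ hv => ?_
      have := hdeg v
      rw [hmem] at hv
      omega
    have h2 : ∑ v, (G.degree v : ℤ) = 2 * G.edgeFinset.card := by
      exact_mod_cast G.sum_degrees_eq_twice_card_edges
    rw [h1, Finset.sum_sub_distrib, h2, Finset.sum_const, Finset.card_univ, nsmul_eq_mul]
    ring
  rw [Finset.sum_add_distrib, Finset.sum_add_distrib, ← Finset.mul_sum, ← Finset.mul_sum, hswap,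
    ← hK, ← Finset.sum_filter, hfilter, hoff S fun v => (G.degree v : ℤ) - 2, hdegsum] at hsum
  rw [Finset.sum_const (2 : ℤ), Finset.card_univ, nsmul_eq_mul] at hfour
  norm_num only at hfour
  rw [hfour] at hsum
  linarith

theorem le_totalConnectivity {D : Digraph V} (h : ∀ u v, Relation.ReflTransGen D.Adj u v) :
    Fintype.card V * (Fintype.card V - 1) ≤ D.totalConnectivity := by
  classical
  have h1 := Finset.sum_le_sum fun p (_ : p ∈ (Finset.univ : Finset V).offDiag) =>
    one_le_pathConnectivity (h p.1 p.2)
  rw [Finset.sum_const, Finset.offDiag_card, Finset.card_univ, smul_eq_mul, mul_one] at h1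
  rw [Nat.mul_sub_one]
  refine h1.trans (le_of_eq ?_)
  unfold totalConnectivity
  congr!

end Digraph

/-! ### The bounds on the average. -/

theorem theorem4p6 {V : Type*} [Fintype V] (G : SimpleGraph V) (n : ℕ)
    (hn : Fintype.card V = n) (hn3 : 3 ≤ n) (hG : G.IsMinimallyConnected 2) :
    1 ≤ G.maxAverageConnectivity ∧
      G.maxAverageConnectivity ≤ 1 + ((n : ℝ) - 3) ^ 2 / (4 * (n : ℝ) * ((n : ℝ) - 1)) ∧
      1 + ((n : ℝ) - 3) ^ 2 / (4 * (n : ℝ) * ((n : ℝ) - 1)) < 5 / 4 := by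
  classical
  subst hn
  have hn3' : (3 : ℝ) ≤ Fintype.card V := by exact_mod_cast hn3
  have hpos : 0 < (Fintype.card V : ℝ) * ((Fintype.card V : ℝ) - 1) := by
    apply mul_pos <;> linarith
  have hcut := SimpleGraph.noCutVertex_of_two_le hG.vertexConnectivity_eq.ge
  have hsep := SimpleGraph.everyEdgeSeparates_of_lt hcut hn3 hG.vertexConnectivity_deleteEdges_lt
  refine ⟨?_, ?_, ?_⟩
  · obtain ⟨D, hD, hstrong⟩ := SimpleGraph.exists_orientation_reflTransGen
      (hcut.preconnected hn3) (fun B x y => hcut.exists_adj_ne hn3 B)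
    refine le_trans ?_ (G.isGreatest_maxAverageConnectivity.2 ⟨D, hD, rfl⟩)
    have h1 := Digraph.le_totalConnectivity hstrong
    rw [Digraph.averageConnectivity, one_le_div hpos]
    have h2 : ((Fintype.card V * (Fintype.card V - 1) : ℕ) : ℝ) ≤ D.totalConnectivity := by
      exact_mod_cast h1
    rwa [Nat.cast_mul, Nat.cast_sub (by omega), Nat.cast_one] at h2
  · obtain ⟨D, hD, hmax⟩ := G.isGreatest_maxAverageConnectivity.1
    rw [← hmax, Digraph.averageConnectivity, div_le_iff₀ hpos, add_mul, one_mul,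
      mul_assoc 4, div_mul_eq_mul_div, mul_div_mul_right _ _ hpos.ne']
    have hdeg := hcut.two_le_degree hn3
    have hK := hD.totalConnectivity_le hdeg
    have hm := SimpleGraph.card_edgeFinset_add_card_filter_le hcut hsep hdeg hn3
    have hmn : Fintype.card V ≤ G.edgeFinset.card := by
      have h1 := G.sum_degrees_eq_twice_card_edges
      have h2 := Finset.sum_le_sum fun v (_ : v ∈ Finset.univ) => hdeg v
      rw [Finset.sum_const, smul_eq_mul, Finset.card_univ] at h2
      omega
    have hprod : 4 * ((((Finset.univ.filter fun v => 3 ≤ G.degree v).card : ℤ) - 1) *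
        (G.edgeFinset.card - Fintype.card V)) ≤ ((Fintype.card V : ℤ) - 3) ^ 2 := by
      -- Without branch vertices the first factor is `-1` and the product is not positive; otherwise
      -- `4ab ≤ (a+b)²` applies, with `a + b ≥ 0` needed for squaring.
      rcases Nat.eq_zero_or_pos (Finset.univ.filter fun v => 3 ≤ G.degree v).card with h0 | h0
      · rw [h0, Nat.cast_zero]
        have : (0 : ℤ) ≤ G.edgeFinset.card - Fintype.card V := by omega
        nlinarith [sq_nonneg ((Fintype.card V : ℤ) - 3)]
      · set a : ℤ := ((Finset.univ.filter fun v => 3 ≤ G.degree v).card : ℤ) - 1 with ha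
        set b : ℤ := (G.edgeFinset.card : ℤ) - Fintype.card V with hb
        have h3 : 0 ≤ a + b := by omega
        have h4 : a + b ≤ (Fintype.card V : ℤ) - 3 := by omega
        have h5 := pow_le_pow_left₀ h3 h4 2
        nlinarith [sq_nonneg (a - b)]
    have hK' : (4 : ℤ) * D.totalConnectivity ≤
        4 * (Fintype.card V * (Fintype.card V - 1)) + ((Fintype.card V : ℤ) - 3) ^ 2 := by
      linarith
    have hK'' : (4 : ℝ) * D.totalConnectivity ≤
        4 * (Fintype.card V * (Fintype.card V - 1)) + ((Fintype.card V : ℝ) - 3) ^ 2 := by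
      exact_mod_cast hK'
    linarith
  · have h : ((Fintype.card V : ℝ) - 3) ^ 2 /
        (4 * (Fintype.card V : ℝ) * ((Fintype.card V : ℝ) - 1)) < 1 / 4 := by
      -- The inequality amounts to `9 < 5n`.
      rw [div_lt_iff₀ (by nlinarith)]
      nlinarith
    linarith
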